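/- **Definitions.** For $\epsilon\in(0,1)$, a matrix $\mathbf A\in\mathbb C^{m\times n}$ is an *$\epsilon$-JL embedding* of $S\subset\mathbb C^n$ if for every $\mathbf x\in S$ there is $\epsilon_{\mathbf x}\in(-\epsilon,\epsilon)$ with $\|\mathbf A\mathbf x\|_2^2=(1+\epsilon_{\mathbf x})\|\mathbf x\|_2^2$. For $\eta\in(0,1/2)$, a family $\{\mathcal D_{(m,n)}\}_{m,n}$, where $\mathcal D_{(m,n)}$ is a probability distribution over complex $m\times n$ matrices, is an *$\eta$-optimal family of JL embedding distributions with constant $c>0$* if for all $\epsilon\in(0,1)$, all $m<n$ and all nonempty $S\subset\mathbb C^n$ with $|S|\le\eta\exp(\epsilon^2m/c)$, a matrix $\mathbf A\sim\mathcal D_{(m,n)}$ is an $\epsilon$-JL embedding of $S$ with probability at least $1-\eta$. For tensors, $\|\cdot\|$ is the Euclidean norm of the entries; $(\mathcal Z\times_j\mathbf U)_{i_1,\dots,\ell,\dots,i_d}=\sum_{i_j}\mathcal Z_{i_1,\dots,i_j,\dots,i_d}\mathbf U_{\ell,i_j}$ is the $j$-mode product; $\mathrm{vect}$ is the vectorization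 of a tensor; $\bigcirc$ is the outer product. For rank-one tensors $\bigcirc_{\ell=1}^d\mathbf y_k^{(\ell)}$, $k\in[r]$, with $\|\mathbf y_k^{(\ell)}\|_2=1$, put $\mu_{\mathcal B}:=\max_{\ell\in[d]}\max_{k\ne h}|\langle\mathbf y_k^{(\ell)},\mathbf y_h^{(\ell)}\rangle|$ (which is $0$ if $r=1$). **Theorem.** For every $c>0$ there are constants $K(c)>0$ and $K'(c)>0$, depending on nothing but $c$, such that the following holds. Let $\epsilon,\eta\in(0,1/2)$, $d\ge3$, $r\ge1$, $\mathcal X\in\mathbb C^{n_1\times\dots\times n_d}$ and $n:=\max_jn_j\ge4r+1$. Let $\mathcal L\subset\mathbb C^{n_1\times\dots\times n_d}$ be an $r$-dimensional subspace spanned by a basis $\mathcal B=\{\bigcirc_{\ell=1}^d\mathbf y_k^{(\ell)}\mid k\in[r]\}$ of rank-one tensors with $\|\mathbf y_k^{(\ell)}\|_2=1$ for all $k,\ell$, and with $\mu_{\mathcal B}^{d-1}<1/(2r)$. For each $j\in[d]$ let $m_j<n_j$ satisfy $$m_j\ \ge\ C_j\cdot\frac{r\,d^3}{\epsilon^2}\cdot\ln\!\left(\frac{n}{\sqrt[d]{\eta}}\right),\qquad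 C_j:=K(c_j),$$ and draw $\mathbf A_j\in\mathbb C^{m_j\times n_j}$ from an $(\eta/(4d))$-optimal family of JL embedding distributions with constant $c_j>0$. Let $m'<\prod_{\ell=1}^dm_\ell$ satisfy $$m'\ \ge\ C'\,r\,\epsilon^{-2}\ln\!\left(\frac{47}{\epsilon\sqrt[r]{\eta}}\right),\qquad C':=K'(c'),$$ and draw $\mathbf A\in\mathbb C^{m'\times\prod_{\ell}m_\ell}$ from an $(\eta/2)$-optimal family of JL embedding distributions with constant $c'>0$. The matrices $\mathbf A_1,\dots,\mathbf A_d,\mathbf A$ are drawn independently, and the $d+1$ families may be different. Put $L(\mathcal Z)=\mathcal Z\times_1\mathbf A_1\cdots\times_d\mathbf A_d$. Then, with probability at least $1-\eta$, $$\left|\,\left\|\mathbf A\left(\mathrm{vect}\circ L(\mathcal X-\mathcal Y)\right)\right\|_2^2-\|\mathcal X-\mathcal Y\|^2\right|\ \le\ \epsilon\,\|\mathcal X-\mathcal Y\|^2\qquad\text{for all }\mathcal Y\in\mathcal L .$$ -/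

import Mathlib

open MeasureTheory

noncomputable section

namespace ModewiseJL

/-- The product (equivalently, Borel) sigma-algebra on complex matrices, entry by entry. -/
instance instMeasurableSpaceMatrix (m n : ℕ) : MeasurableSpace (Matrix (Fin m) (Fin n) ℂ) :=
  inferInstanceAs (MeasurableSpace (Fin m → Fin n → ℂ))

/-! ### Johnson-Lindenstrauss embeddings and optimal families of distributions -/

/-- The matrix `A` acting on Euclidean space `ℂⁿ`. -/
def act {m n : ℕ} (A : Matrix (Fin m) (Fin n) ℂ) (x : EuclideanSpace ℂ (Fin n)) :
    EuclideanSpace ℂ (Fin m) :=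
  Matrix.toEuclideanLin A x

/-- `A` is an `ε`-JL embedding of the set `S ⊆ ℂⁿ` into `ℂᵐ`. -/
def IsJLEmbedding {m n : ℕ} (ε : ℝ) (A : Matrix (Fin m) (Fin n) ℂ)
    (S : Set (EuclideanSpace ℂ (Fin n))) : Prop :=
  ∀ x ∈ S, ∃ εx ∈ Set.Ioo (-ε) ε, ‖act A x‖ ^ 2 = (1 + εx) * ‖x‖ ^ 2

/-- `D` is an `η`-optimal family of JL embedding distributions, with constant `C`: every
`D m n` is a probability distribution over `m × n` matrices, and for all `ε ∈ (0,1)`, all `m < n`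
and every nonempty finite set `S ⊆ ℂⁿ` of cardinality at most `η exp (ε² m / C)`, a matrix drawn
from `D m n` is an `ε`-JL embedding of `S` with probability at least `1 - η`. -/
def IsOptimalFamilyWith (η C : ℝ) (D : ∀ m n : ℕ, Measure (Matrix (Fin m) (Fin n) ℂ)) : Prop :=
  (∀ m n, IsProbabilityMeasure (D m n)) ∧
  ∀ ε : ℝ, 0 < ε → ε < 1 → ∀ m n : ℕ, m < n →
    ∀ S : Finset (EuclideanSpace ℂ (Fin n)), S.Nonempty →
      (S.card : ℝ) ≤ η * Real.exp (ε ^ 2 * m / C) →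
      ENNReal.ofReal (1 - η) ≤ D m n {A | IsJLEmbedding ε A (S : Set _)}

/-! ### Tensors -/

/-- `d`-mode complex tensors of shape `n 0 × ⋯ × n (d-1)`, with the Euclidean inner product and
norm. -/
abbrev Tensor {d : ℕ} (n : Fin d → ℕ) : Type := EuclideanSpace ℂ (∀ j, Fin (n j))

/-- The outer product of `d` vectors. -/
def outer {d : ℕ} {n : Fin d → ℕ} (y : ∀ j, EuclideanSpace ℂ (Fin (n j))) : Tensor n :=
  WithLp.toLp 2 fun i => ∏ j, y j (i j)

/-- Identification of tensors along an equality of shapes (all entries are kept). -/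
def reshape {d : ℕ} {n n' : Fin d → ℕ} (h : ∀ l, n' l = n l) (Z : Tensor n) : Tensor n' :=
  WithLp.toLp 2 fun i => Z fun l => Fin.cast (h l) (i l)

/-- The multi-index `i` (of a shape `n'` that agrees with `n` outside mode `j`), with its `j`-th
index replaced by `a`. -/
def replaceIdx {d : ℕ} {n n' : Fin d → ℕ} (j : Fin d) (h : ∀ l, l ≠ j → n' l = n l)
    (i : ∀ l, Fin (n' l)) (a : Fin (n j)) : ∀ l, Fin (n l) :=
  fun l => if hl : l = j then Fin.cast (by rw [hl]) a else Fin.cast (h l hl) (i l)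

/-- The `j`-mode product `Z ×ⱼ U`. Its shape `n'` agrees with `n` outside mode `j`. -/
def modeProduct {d : ℕ} {n n' : Fin d → ℕ} (j : Fin d) (h : ∀ l, l ≠ j → n' l = n l)
    (U : Matrix (Fin (n' j)) (Fin (n j)) ℂ) (Z : Tensor n) : Tensor n' :=
  WithLp.toLp 2 fun i => ∑ a : Fin (n j), Z (replaceIdx j h i a) * U (i j) a

/-- The shape after the first `t` mode products: `m l` for `l < t`, and `n l` otherwise. -/
def stepShape {d : ℕ} (n m : Fin d → ℕ) (t : ℕ) : Fin d → ℕ :=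
  fun l => if l.val < t then m l else n l

theorem stepShape_zero {d : ℕ} (n m : Fin d → ℕ) (l : Fin d) : stepShape n m 0 l = n l := by
  simp [stepShape]

theorem stepShape_full {d : ℕ} (n m : Fin d → ℕ) (l : Fin d) : m l = stepShape n m d l := by
  simp [stepShape]

theorem stepShape_self {d : ℕ} (n m : Fin d → ℕ) (l : Fin d) : stepShape n m l.val l = n l := by
  simp [stepShape]

theorem stepShape_succ_self {d : ℕ} (n m : Fin d → ℕ) (l : Fin d) :
    stepShape n m (l.val + 1) l = m l := by
  simp [stepShape]

theorem stepShape_succ_of_ne {d : ℕ} (n m : Fin d → ℕ) (j l : Fin d) (hl : l ≠ j) :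
    stepShape n m (j.val + 1) l = stepShape n m j.val l := by
  have h : l.val ≠ j.val := fun h => hl (Fin.ext h)
  have h' : (l.val < j.val + 1) ↔ l.val < j.val := by omega
  simp only [stepShape, h']

/-- `Z ×₁ A₁ ⋯ ×ₜ Aₜ`, for `t ≤ d`. -/
def partialModewise {d : ℕ} {n m : Fin d → ℕ} (A : ∀ j, Matrix (Fin (m j)) (Fin (n j)) ℂ)
    (Z : Tensor n) : (t : ℕ) → t ≤ d → Tensor (stepShape n m t)
  | 0, _ => reshape (stepShape_zero n m) Z
  | t + 1, ht =>
      modeProduct (⟨t, ht⟩ : Fin d) (stepShape_succ_of_ne n m ⟨t, ht⟩)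
        ((A ⟨t, ht⟩).submatrix (Fin.cast (stepShape_succ_self n m ⟨t, ht⟩))
          (Fin.cast (stepShape_self n m ⟨t, ht⟩)))
        (partialModewise A Z t (Nat.le_of_succ_le ht))

/-- `Z ×₁ A₁ ⋯ ×_d A_d`. -/
def modewise {d : ℕ} {n m : Fin d → ℕ} (A : ∀ j, Matrix (Fin (m j)) (Fin (n j)) ℂ)
    (Z : Tensor n) : Tensor m :=
  reshape (stepShape_full n m) (partialModewise A Z d le_rfl)

/-- Vectorization of a tensor (the first index varies fastest). -/
def vect {d : ℕ} {m : Fin d → ℕ} (Z : Tensor m) : EuclideanSpace ℂ (Fin (∏ j, m j)) :=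
  WithLp.toLp 2 fun q => Z (finPiFinEquiv.symm q)

/-! ### Coherence -/

/-- The modewise coherence in one mode: the maximum of `|⟨y_k, y_h⟩|` over `k ≠ h`
(it is `0` when there is no such pair). -/
def modeCoherence {r N : ℕ} (y : Fin r → EuclideanSpace ℂ (Fin N)) : ℝ :=
  ⨆ p : {p : Fin r × Fin r // p.1 ≠ p.2}, ‖inner ℂ (y p.1.1) (y p.1.2)‖

/-- The maximum modewise coherence of the family of rank-one tensors `○_ℓ y ℓ k`. -/
def maxCoherence {d r : ℕ} {n : Fin d → ℕ}
    (y : ∀ l : Fin d, Fin r → EuclideanSpace ℂ (Fin (n l))) : ℝ :=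
  ⨆ l, modeCoherence (y l)

/-! ### The entries of a modewise product -/

/-- Replacing the `j`-th index: the pairs (index of shape `n'`, `j`-th index of shape `n`)
correspond to the pairs (index of shape `n`, `j`-th index of shape `n'`). -/
def swapEquiv {d : ℕ} {n n' : Fin d → ℕ} (j : Fin d) (h : ∀ l, l ≠ j → n' l = n l) :
    ((∀ l, Fin (n' l)) × Fin (n j)) ≃ ((∀ l, Fin (n l)) × Fin (n' j)) where
  toFun p := (replaceIdx j h p.1 p.2, p.1 j)
  invFun p := (replaceIdx j (fun l hl => (h l hl).symm) p.1 p.2, p.1 j)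
  left_inv p := by
    refine Prod.ext (funext fun l => ?_) ?_
    · by_cases hl : l = j
      · subst hl; simp [replaceIdx]
      · simp [replaceIdx, hl]
    · simp [replaceIdx]
  right_inv p := by
    refine Prod.ext (funext fun l => ?_) ?_
    · by_cases hl : l = j
      · subst hl; simp [replaceIdx]
      · simp [replaceIdx, hl]
    · simp [replaceIdx]

/-- `∑_k Z_k ∏_l (A_l)_{i_l, k_l}`. -/
def closedForm {d : ℕ} {n m : Fin d → ℕ} (A : ∀ j, Matrix (Fin (m j)) (Fin (n j)) ℂ)
    (Z : Tensor n) (i : ∀ l, Fin (m l)) : ℂ :=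
  ∑ k : (∀ l, Fin (n l)), Z k * ∏ l, A l (i l) (k l)

theorem closedForm_modeProduct {d : ℕ} {n n' m : Fin d → ℕ} (j : Fin d)
    (h : ∀ l, l ≠ j → n' l = n l) (U : Matrix (Fin (n' j)) (Fin (n j)) ℂ)
    (B : ∀ l, Matrix (Fin (m l)) (Fin (n' l)) ℂ) (B' : ∀ l, Matrix (Fin (m l)) (Fin (n l)) ℂ)
    (hj : B' j = B j * U)
    (hne : ∀ l (hl : l ≠ j), B' l = (B l).submatrix (fun a => a) (Fin.cast (h l hl).symm))
    (Z : Tensor n) (i : ∀ l, Fin (m l)) :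
    closedForm B (modeProduct j h U Z) i = closedForm B' Z i := by
  classical
  have h1 : closedForm B (modeProduct j h U Z) i =
      ∑ p : (∀ l, Fin (n' l)) × Fin (n j),
        Z (replaceIdx j h p.1 p.2) * U (p.1 j) p.2 * ∏ l, B l (i l) (p.1 l) := by
    rw [Fintype.sum_prod_type]
    simp [closedForm, modeProduct, Finset.sum_mul]
  have h2 : closedForm B' Z i =
      ∑ p : (∀ l, Fin (n l)) × Fin (n' j),
        Z p.1 * (B j (i j) p.2 * U p.2 (p.1 j) *
          ∏ l ∈ Finset.univ.erase j, B' l (i l) (p.1 l)) := by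
    rw [Fintype.sum_prod_type]
    refine Finset.sum_congr rfl fun k _ => ?_
    rw [← Finset.mul_prod_erase Finset.univ (fun l => B' l (i l) (k l)) (Finset.mem_univ j), hj,
      Matrix.mul_apply, Finset.sum_mul, Finset.mul_sum]
  rw [h1, h2]
  refine Fintype.sum_equiv (swapEquiv j h) _ _ fun p => ?_
  have h3 : ∏ l ∈ Finset.univ.erase j, B' l (i l) ((swapEquiv j h p).1 l) =
      ∏ l ∈ Finset.univ.erase j, B l (i l) (p.1 l) := by
    refine Finset.prod_congr rfl fun l hl => ?_
    have hl' : l ≠ j := Finset.ne_of_mem_erase hl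
    rw [hne l hl']
    simp [swapEquiv, replaceIdx, hl']
  rw [h3, ← Finset.mul_prod_erase Finset.univ (fun l => B l (i l) (p.1 l)) (Finset.mem_univ j)]
  have h4 : (swapEquiv j h p).1 j = p.2 := by simp [swapEquiv, replaceIdx]
  have h5 : (swapEquiv j h p).2 = p.1 j := rfl
  have h6 : (swapEquiv j h p).1 = replaceIdx j h p.1 p.2 := rfl
  rw [h4, h5, h6]
  ring

/-- The matrices still to be applied after `t` steps. -/
def remaining {d : ℕ} {n m : Fin d → ℕ} (A : ∀ j, Matrix (Fin (m j)) (Fin (n j)) ℂ) (t : ℕ)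
    (l : Fin d) : Matrix (Fin (m l)) (Fin (stepShape n m t l)) ℂ :=
  if hl : l.val < t then
    (1 : Matrix (Fin (m l)) (Fin (m l)) ℂ).submatrix (fun a => a)
      (Fin.cast (by simp [stepShape, hl]))
  else (A l).submatrix (fun a => a) (Fin.cast (by simp [stepShape, hl]))

theorem closedForm_reshape {d : ℕ} {n n' m : Fin d → ℕ} (h : ∀ l, n' l = n l)
    (B : ∀ l, Matrix (Fin (m l)) (Fin (n' l)) ℂ) (Z : Tensor n) (i : ∀ l, Fin (m l)) :
    closedForm B (reshape h Z) i =
      closedForm (fun l => (B l).submatrix (fun a => a) (Fin.cast (h l).symm)) Z i := by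
  obtain rfl : n' = n := funext h
  rfl

theorem closedForm_partialModewise {d : ℕ} {n m : Fin d → ℕ}
    (A : ∀ j, Matrix (Fin (m j)) (Fin (n j)) ℂ) (Z : Tensor n) (i : ∀ l, Fin (m l)) :
    ∀ (t : ℕ) (ht : t ≤ d),
      closedForm (remaining A t) (partialModewise A Z t ht) i = closedForm A Z i
  | 0, _ => by
      rw [partialModewise, closedForm_reshape]
      congr 1
  | t + 1, ht => by
      rw [partialModewise, ← closedForm_partialModewise A Z i t (Nat.le_of_succ_le ht)]
      refine closedForm_modeProduct _ _ _ _ _ ?_ ?_ _ _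
      · have h1 : ¬ (t < t) := lt_irrefl t
        ext a b
        simp only [remaining, h1, Nat.lt_succ_self, dite_true, dite_false, Matrix.mul_apply,
          Matrix.submatrix_apply]
        rw [Finset.sum_eq_single (Fin.cast (stepShape_succ_self n m ⟨t, ht⟩).symm a)]
        · exact ((congrArg (· * _) (Matrix.one_apply_eq a)).trans (one_mul _)).symm
        · intro x _ hx
          rw [Matrix.one_apply_ne, zero_mul]
          exact fun h => hx (Fin.ext (congrArg Fin.val h).symm)
        · simp
      · intro l hl
        have h : l.val ≠ t := fun h => hl (Fin.ext h)
        by_cases hlt : l.val < t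
        · have : l.val < t + 1 := by omega
          simp only [remaining, hlt, this, dite_true]
          rfl
        · have : ¬ l.val < t + 1 := by omega
          simp only [remaining, hlt, this, dite_false]
          rfl

/-- The entries of `Z ×₁ A₁ ⋯ ×_d A_d`. -/
theorem modewise_apply {d : ℕ} {n m : Fin d → ℕ} (A : ∀ j, Matrix (Fin (m j)) (Fin (n j)) ℂ)
    (Z : Tensor n) (i : ∀ l, Fin (m l)) :
    modewise A Z i = ∑ k : (∀ l, Fin (n l)), Z k * ∏ l, A l (i l) (k l) := by
  classical
  change _ = closedForm A Z i
  rw [← closedForm_partialModewise A Z i d le_rfl]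
  unfold closedForm
  rw [Finset.sum_eq_single (fun l => Fin.cast (stepShape_full n m l) (i l))]
  · have h1 : ∏ l, remaining A d l (i l) (Fin.cast (stepShape_full n m l) (i l)) = 1 := by
      refine Finset.prod_eq_one fun l _ => ?_
      simp only [remaining, l.isLt, dite_true, Matrix.submatrix_apply]
      exact Matrix.one_apply_eq (i l)
    rw [h1, mul_one]
    rfl
  · intro k _ hk
    obtain ⟨l, hl⟩ := Function.ne_iff.mp hk
    refine mul_eq_zero_of_right _ (Finset.prod_eq_zero (Finset.mem_univ l) ?_)
    simp only [remaining, l.isLt, dite_true, Matrix.submatrix_apply]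
    exact Matrix.one_apply_ne fun h => hl (Fin.ext (congrArg Fin.val h).symm)
  · simp

end ModewiseJL

end

/-! All differences `X - Y` with `Y ∈ L` lie in `W = L ⊔ span {X}`, of dimension at most `r + 1`. It
therefore suffices that the modewise map and the final matrix each distort squared norms by a factor
within `ε / 3` of 1, on `W` and on the image of `W` respectively, because `(1 + ε / 3) ^ 2 ≤ 1 + ε`.

Finite sets suffice for a subspace. If a linear map distorts the squared norms on a `1/4`-net of the
unit ball by at most `δ`, then it distorts all squared norms by at most `7 * δ`
(`abs_norm_sq_sub_le_of_net`). In complex dimension `k` such a net needs at most `25 ^ (2 * k)`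
points.

For a fixed tensor the modes are treated one at a time. A mode product acts separately on the
mode-`j` fibers, whose squared norms add up to that of the tensor, so preserving every fiber up to
`δ` costs a factor in `[1 - δ, 1 + δ]` per mode (`norm_modewise_bounds`). The fibers met at mode `j`
depend only on the matrices of earlier modes. By independence those can be frozen, and the JL
property of `A j` applied to finitely many fixed vectors (`measure_not_preservesFibers_le`); a union
bound over modes and the net lemma give the modewise stage. Padding the matrices with zero rows
makes them square, so that all intermediate tensors share one index type.

Once the modewise matrices are fixed, the image of `W` is a fixed subspace of dimension at most `r +
1`, and the net lemma handles the last matrix. The two stages are combined by integrating over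
sections (`mul_le_prod_of_section_le`). -/

noncomputable section

namespace ModewiseJL

/-! ### Nets of the unit ball and quadratic forms -/

/-- The ball of radius `2` has a `1`-net of cardinality at most `5 ^ dim`. -/
theorem exists_one_net_ball_two (E : Type*) [NormedAddCommGroup E] [NormedSpace ℝ E]
    [FiniteDimensional ℝ E] :
    ∃ s : Finset E, s.card ≤ 5 ^ Module.finrank ℝ E ∧
      ∀ x : E, ‖x‖ ≤ 2 → ∃ y ∈ s, ‖x - y‖ ≤ 1 := by
  classical
  let P : Finset E → Prop := fun s =>
    (∀ c ∈ s, ‖c‖ ≤ 2) ∧ ∀ c ∈ s, ∀ d ∈ s, c ≠ d → 1 ≤ ‖c - d‖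
  have hb : ∀ s, P s → s.card ≤ 5 ^ Module.finrank ℝ E := fun s hs =>
    Besicovitch.card_le_of_separated s hs.1 hs.2
  -- A 1-separated subset of the ball of largest cardinality, which exists by the packing bound
  -- `hb`. A point farther than 1 from all of `s` could be added to it, so `s` is a net.
  obtain ⟨s, hs, hk⟩ := Nat.findGreatest_spec (P := fun k => ∃ s, P s ∧ s.card = k)
    (Nat.zero_le (5 ^ Module.finrank ℝ E)) ⟨∅, by simp [P], rfl⟩
  refine ⟨s, hb s hs, fun x hx => ?_⟩
  by_contra! h
  have hxs : x ∉ s := fun hxs => by simpa using (h x hxs).trans_le' zero_le_one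
  have hP : P (insert x s) := by
    refine ⟨by simpa [hx] using hs.1, ?_⟩
    intro c hc d hd hcd
    rw [Finset.mem_insert] at hc hd
    rcases hc with rfl | hc <;> rcases hd with rfl | hd
    · exact absurd rfl hcd
    · exact (h d hd).le
    · rw [norm_sub_rev]; exact (h c hc).le
    · exact hs.2 c hc d hd hcd
  have h1 := Nat.le_findGreatest (P := fun k => ∃ s, P s ∧ s.card = k)
    (hb _ hP) ⟨_, hP, rfl⟩
  rw [Finset.card_insert_of_notMem hxs] at h1
  omega

/-- The unit ball has a `1/4`-net of cardinality at most `25 ^ dim`. -/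
theorem exists_quarter_net (E : Type*) [NormedAddCommGroup E] [NormedSpace ℝ E]
    [FiniteDimensional ℝ E] :
    ∃ s : Finset E, s.Nonempty ∧ s.card ≤ 25 ^ Module.finrank ℝ E ∧
      ∀ x : E, ‖x‖ ≤ 1 → ∃ y ∈ s, ‖x - y‖ ≤ 1 / 4 := by
  classical
  obtain ⟨s, hc, hs⟩ := exists_one_net_ball_two E
  let t := (s ×ˢ s).image fun p => (1 / 2 : ℝ) • p.1 + (1 / 4 : ℝ) • p.2
  have ht : ∀ x : E, ‖x‖ ≤ 1 → ∃ y ∈ t, ‖x - y‖ ≤ 1 / 4 := by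
    intro x hx
    -- The net of the ball of radius 2 is used twice: `2x` is approximated by `a`, then the doubled
    -- error `2(2x - a)`, again of norm at most 2, by `b`. This halves the error twice and squares
    -- the cardinality.
    obtain ⟨a, ha, hxa⟩ := hs ((2 : ℝ) • x) (by rw [norm_smul]; norm_num; linarith)
    obtain ⟨b, hb, hxb⟩ := hs ((2 : ℝ) • ((2 : ℝ) • x - a)) (by rw [norm_smul]; norm_num; linarith)
    refine ⟨_, Finset.mem_image_of_mem _ (Finset.mk_mem_product ha hb), ?_⟩
    have : x - ((1 / 2 : ℝ) • a + (1 / 4 : ℝ) • b) =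
        (1 / 4 : ℝ) • ((2 : ℝ) • ((2 : ℝ) • x - a) - b) := by module
    rw [this, norm_smul]
    norm_num
    linarith
  refine ⟨t, ?_, ?_, ht⟩
  · obtain ⟨y, hy, -⟩ := ht 0 (by simp)
    exact ⟨y, hy⟩
  · calc t.card ≤ (s ×ˢ s).card := Finset.card_image_le
      _ = s.card * s.card := Finset.card_product _ _
      _ ≤ 5 ^ Module.finrank ℝ E * 5 ^ Module.finrank ℝ E := Nat.mul_le_mul hc hc
      _ = 25 ^ Module.finrank ℝ E := by rw [← mul_pow]; norm_num

/-- A linear map that nearly preserves the norms of a `1/4`-net of the unit ball nearly preserves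
all norms. -/
theorem abs_norm_sq_sub_le_of_net {E F : Type*} [NormedAddCommGroup E] [InnerProductSpace ℝ E]
    [FiniteDimensional ℝ E] [NormedAddCommGroup F] [InnerProductSpace ℝ F]
    (f : E →ₗ[ℝ] F) {δ : ℝ} (hδ : 0 ≤ δ) (s : Set E)
    (hs : ∀ x : E, ‖x‖ ≤ 1 → ∃ y ∈ s, ‖x - y‖ ≤ 1 / 4)
    (hf : ∀ y ∈ s, |‖f y‖ ^ 2 - ‖y‖ ^ 2| ≤ δ * ‖y‖ ^ 2) (x : E) :
    |‖f x‖ ^ 2 - ‖x‖ ^ 2| ≤ 7 * δ * ‖x‖ ^ 2 := by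
  rcases subsingleton_or_nontrivial E with hE | hE
  · simp [Subsingleton.elim x 0]
  set Q : E → ℝ := fun x => ‖f x‖ ^ 2 - ‖x‖ ^ 2 with hQ
  have hcont : Continuous fun x => |Q x| := by
    have := f.continuous_of_finiteDimensional
    fun_prop
  -- By homogeneity the maximum `M` of `|Q|` on the sphere controls `Q` everywhere; `M` is then
  -- bounded in terms of itself by comparing `u` with a nearby net point.
  obtain ⟨u, hu, hmax⟩ := (isCompact_sphere (0 : E) 1).exists_isMaxOn
    (NormedSpace.sphere_nonempty.mpr zero_le_one) hcont.continuousOn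
  have hu1 : ‖u‖ = 1 := by simpa using hu
  set M := |Q u| with hM
  have hsmul : ∀ (a : ℝ) z, Q (a • z) = a ^ 2 * Q z := by
    intro a z
    simp only [hQ, map_smul, norm_smul, mul_pow, Real.norm_eq_abs, sq_abs]
    ring
  have hall : ∀ z, |Q z| ≤ M * ‖z‖ ^ 2 := by
    intro z
    by_cases hz : z = 0
    · simp [hz, hQ]
    have hz' : ‖z‖ ≠ 0 := norm_ne_zero_iff.mpr hz
    have h1 : |Q (‖z‖⁻¹ • z)| ≤ M :=
      hmax (by simp [norm_smul, hz'])
    have h2 : Q z = ‖z‖ ^ 2 * Q (‖z‖⁻¹ • z) := by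
      rw [hsmul]; field_simp
    rw [h2, abs_mul, abs_of_nonneg (sq_nonneg _), mul_comm]
    gcongr
  obtain ⟨y, hy, huy⟩ := hs u hu1.le
  have hy1 : ‖y‖ ≤ 5 / 4 := by
    have := norm_le_norm_add_norm_sub u y
    linarith
  -- `Q u - Q y` is the polar form of `Q` at `(u - y, u + y)`. The factors 2 and 1/2 leave it
  -- unchanged and bring the norms of the two arguments closer; unscaled, the estimate would give a
  -- coefficient of `M` above 1.
  set a := (2 : ℝ) • (u - y)
  set b := (1 / 2 : ℝ) • (u + y)
  have ha : ‖a‖ ≤ 1 / 2 := by simp only [a, norm_smul]; norm_num; linarith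
  have hb : ‖b‖ ≤ 9 / 8 := by
    have := norm_add_le u y
    simp only [b, norm_smul]; norm_num; linarith
  have key : Q u - Q y = (Q (b + a) - Q (b - a)) / 4 := by
    have h1 : u = b + (1 / 4 : ℝ) • a := by simp only [a, b]; module
    have h2 : y = b - (1 / 4 : ℝ) • a := by simp only [a, b]; module
    clear_value a b
    subst h1 h2
    simp only [hQ, map_add, map_sub, map_smul, norm_add_sq_real, norm_sub_sq_real,
      inner_smul_right, norm_smul]
    ring
  have hpar : ‖b + a‖ ^ 2 + ‖b - a‖ ^ 2 = 2 * ‖b‖ ^ 2 + 2 * ‖a‖ ^ 2 := by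
    rw [norm_add_sq_real, norm_sub_sq_real]; ring
  have hM0 : 0 ≤ M := abs_nonneg _
  -- The bounds combine to `M ≤ (25/16) δ + (97/128) M`, hence `M ≤ (200/31) δ`.
  have hMb : M ≤ 7 * δ := by
    have h1 := hall (b + a)
    have h2 := hall (b - a)
    have h3 : |Q y| ≤ δ * (5 / 4) ^ 2 := (hf y hy).trans (by gcongr)
    have h4 : ‖b + a‖ ^ 2 + ‖b - a‖ ^ 2 ≤ 2 * (9 / 8) ^ 2 + 2 * (1 / 2) ^ 2 := by
      rw [hpar]; gcongr
    have h5 := mul_le_mul_of_nonneg_left h4 hM0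
    have h6 : M ≤ |Q y| + (|Q (b + a)| + |Q (b - a)|) / 4 := by
      have : Q u = Q y + (Q (b + a) - Q (b - a)) / 4 := by linarith
      rw [hM, this]
      refine (abs_add_le _ _).trans ?_
      rw [abs_div, abs_of_pos (by norm_num : (0 : ℝ) < 4)]
      have := abs_sub (Q (b + a)) (Q (b - a))
      linarith
    linarith
  exact (hall x).trans (by gcongr)


/-! ### Products of square matrices acting on all modes -/

/-- The action of the Kronecker product of the square matrices `M l`. -/
def kron {ι : Type*} [Fintype ι] {κ : ι → Type*} [∀ l, Fintype (κ l)] [DecidableEq ι]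
    (M : ∀ l, Matrix (κ l) (κ l) ℂ) (Z : (∀ l, κ l) → ℂ) (i : ∀ l, κ l) : ℂ :=
  ∑ k : (∀ l, κ l), Z k * ∏ l, M l (i l) (k l)

/-- The mode-`j` fiber of `W` over the multi-index `q` of the other modes. -/
def fiber {ι : Type*} {κ : ι → Type*} [DecidableEq ι] (j : ι) (q : ∀ l : {l // l ≠ j}, κ l)
    (W : (∀ l, κ l) → ℂ) : EuclideanSpace ℂ (κ j) :=
  WithLp.toLp 2 fun a => W ((Equiv.piSplitAt j κ).symm (a, q))

theorem sum_fiber {ι : Type*} [Fintype ι] [DecidableEq ι] {κ : ι → Type*}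
    [∀ l, Fintype (κ l)] (j : ι) (W : (∀ l, κ l) → ℂ) :
    ∑ i, ‖W i‖ ^ 2 = ∑ q, ‖fiber j q W‖ ^ 2 := by
  rw [← (Equiv.piSplitAt j κ).symm.sum_comp, Fintype.sum_prod_type, Finset.sum_comm]
  refine Finset.sum_congr rfl fun q _ => ?_
  rw [EuclideanSpace.norm_sq_eq]
  rfl

section kron

variable {ι : Type*} [Fintype ι] [DecidableEq ι] {κ : ι → Type*} [∀ l, Fintype (κ l)]
  [∀ l, DecidableEq (κ l)]

theorem kron_one (Z : (∀ l, κ l) → ℂ) : kron (fun _ => 1) Z = Z := by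
  ext i
  unfold kron
  rw [Finset.sum_eq_single i]
  · simp
  · intro k _ hk
    obtain ⟨l, hl⟩ := Function.ne_iff.mp hk
    exact mul_eq_zero_of_right _
      (Finset.prod_eq_zero (Finset.mem_univ l) (Matrix.one_apply_ne (Ne.symm hl)))
  · simp

theorem kron_update_apply (M : ∀ l, Matrix (κ l) (κ l) ℂ) (j : ι) (hj : M j = 1)
    (U : Matrix (κ j) (κ j) ℂ) (Z : (∀ l, κ l) → ℂ) (b : κ j) (q : ∀ l : {l // l ≠ j}, κ l) :
    kron (Function.update M j U) Z ((Equiv.piSplitAt j κ).symm (b, q)) =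
      ∑ a, U b a * fiber j q (kron M Z) a := by
  have hsplit : ∀ (M : ∀ l, Matrix (κ l) (κ l) ℂ) (a : κ j) (k : ∀ l, κ l),
      ∏ l, M l ((Equiv.piSplitAt j κ).symm (a, q) l) (k l) =
        M j a (k j) * ∏ l : {l // l ≠ j}, M l (q l) (k l) := by
    intro M a k
    rw [Fintype.prod_eq_mul_prod_subtype_ne _ j]
    congr 1
    · simp [Equiv.piSplitAt]
    · refine Finset.prod_congr rfl fun l _ => ?_
      simp [Equiv.piSplitAt, l.2]
  simp only [kron, fiber, hsplit, Function.update_self, hj]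
  have h1 : ∀ k : (∀ l, κ l), ∏ l : {l // l ≠ j}, Function.update M j U l (q l) (k l) =
      ∏ l : {l // l ≠ j}, M l (q l) (k l) := fun k =>
    Finset.prod_congr rfl fun l _ => by rw [Function.update_of_ne l.2]
  simp only [h1, Finset.mul_sum]
  rw [Finset.sum_comm]
  refine Finset.sum_congr rfl fun k _ => ?_
  -- The identity in mode `j` of `M` kills every term but `a = k j`.
  rw [Finset.sum_eq_single (k j)]
  · simp; ring
  · intro a _ ha
    simp [Matrix.one_apply_ne ha]
  · simp

/-- If `U` nearly preserves the norms of the fibers, then multiplying by `U` in one mode nearly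
preserves the norm of the tensor. -/
theorem abs_sum_kron_update_sub_le (M : ∀ l, Matrix (κ l) (κ l) ℂ) (j : ι) (hj : M j = 1)
    (U : Matrix (κ j) (κ j) ℂ) (Z : (∀ l, κ l) → ℂ) (δ : ℝ)
    (h : ∀ q, |‖Matrix.toEuclideanLin U (fiber j q (kron M Z))‖ ^ 2
      - ‖fiber j q (kron M Z)‖ ^ 2| ≤ δ * ‖fiber j q (kron M Z)‖ ^ 2) :
    |∑ i, ‖kron (Function.update M j U) Z i‖ ^ 2 - ∑ i, ‖kron M Z i‖ ^ 2| ≤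
      δ * ∑ i, ‖kron M Z i‖ ^ 2 := by
  have h1 : ∀ q, fiber j q (kron (Function.update M j U) Z) =
      Matrix.toEuclideanLin U (fiber j q (kron M Z)) := by
    intro q
    ext b
    rw [Matrix.toLpLin_apply]
    exact kron_update_apply M j hj U Z b q
  rw [sum_fiber j, sum_fiber j (kron M Z), ← Finset.sum_sub_distrib, Finset.mul_sum]
  refine (Finset.abs_sum_le_sum_abs _ _).trans (Finset.sum_le_sum fun q _ => ?_)
  rw [h1]
  exact h q

end kron

/-! ### Padding with zero rows -/

/-- The square matrix obtained from `A` by adding zero rows (or deleting the last rows). -/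
def padRows {m n : ℕ} (A : Matrix (Fin m) (Fin n) ℂ) : Matrix (Fin n) (Fin n) ℂ :=
  fun a b => if h : a.val < m then A ⟨a, h⟩ b else 0

theorem act_apply {m n : ℕ} (A : Matrix (Fin m) (Fin n) ℂ) (x : EuclideanSpace ℂ (Fin n))
    (a : Fin m) : act A x a = ∑ b, A a b * x b := by
  rw [act, Matrix.toLpLin_apply]
  rfl

/-- The added coordinates vanish, and `m ≤ n` ensures that no row is deleted. -/
theorem norm_padRows {m n : ℕ} (h : m ≤ n) (A : Matrix (Fin m) (Fin n) ℂ)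
    (x : EuclideanSpace ℂ (Fin n)) :
    ‖Matrix.toEuclideanLin (padRows A) x‖ ^ 2 = ‖act A x‖ ^ 2 := by
  rw [EuclideanSpace.norm_sq_eq, EuclideanSpace.norm_sq_eq]
  symm
  refine Fintype.sum_of_injective (Fin.castLE h) (Fin.castLE_injective h) _ _ ?_ ?_
  · intro a ha
    have ha' : ¬ a.val < m := fun h' => ha ⟨⟨a, h'⟩, rfl⟩
    have := act_apply (padRows A) x a
    rw [act] at this
    rw [this]
    simp [padRows, ha']
  · intro a
    have := act_apply (padRows A) x (Fin.castLE h a)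
    rw [act] at this
    rw [this, act_apply]
    simp [padRows]

theorem sum_kron_padRows {d : ℕ} {n m : Fin d → ℕ} (h : ∀ j, m j ≤ n j)
    (A : ∀ j, Matrix (Fin (m j)) (Fin (n j)) ℂ) (Z : Tensor n) :
    ∑ i, ‖kron (fun l => padRows (A l)) Z i‖ ^ 2 = ‖modewise A Z‖ ^ 2 := by
  rw [EuclideanSpace.norm_sq_eq]
  symm
  refine Fintype.sum_of_injective (fun i l => Fin.castLE (h l) (i l)) ?_ _ _ ?_ ?_
  · intro i i' hi
    funext l
    exact Fin.castLE_injective (h l) (congrFun hi l)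
  · intro i hi
    have : ∃ l, ¬ (i l).val < m l := by
      by_contra! h'
      exact hi ⟨fun l => ⟨i l, h' l⟩, rfl⟩
    obtain ⟨l, hl⟩ := this
    have hz : kron (fun l => padRows (A l)) Z i = 0 :=
      Finset.sum_eq_zero fun k _ => mul_eq_zero_of_right _
        (Finset.prod_eq_zero (Finset.mem_univ l) (by simp [padRows, hl]))
    rw [hz]; simp
  · intro i
    rw [modewise_apply]
    simp [kron, padRows]

/-- The padded matrices of the first `t` modes, and the identity in the other modes. -/
def padFirst {d : ℕ} {n m : Fin d → ℕ} (A : ∀ j, Matrix (Fin (m j)) (Fin (n j)) ℂ) (t : ℕ)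
    (l : Fin d) : Matrix (Fin (n l)) (Fin (n l)) ℂ :=
  if l.val < t then padRows (A l) else 1

/-- `A j` nearly preserves the norms of the mode-`j` fibers of `Z ×₁ A₁ ⋯ ×ⱼ₋₁ Aⱼ₋₁`. -/
def PreservesFibers {d : ℕ} {n m : Fin d → ℕ} (δ : ℝ) (A : ∀ j, Matrix (Fin (m j)) (Fin (n j)) ℂ)
    (Z : Tensor n) (j : Fin d) : Prop :=
  ∀ q, |‖act (A j) (fiber j q (kron (padFirst A j) Z))‖ ^ 2
      - ‖fiber j q (kron (padFirst A j) Z)‖ ^ 2| ≤ δ * ‖fiber j q (kron (padFirst A j) Z)‖ ^ 2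

/-- Induction on the number of modes already multiplied: mode `t` replaces an identity factor by a
padded matrix, at the cost of one factor `1 ± δ`. -/
theorem norm_modewise_bounds {d : ℕ} {n m : Fin d → ℕ} (h : ∀ j, m j ≤ n j) {δ : ℝ}
    (hδ0 : 0 ≤ δ) (hδ : δ ≤ 1) (A : ∀ j, Matrix (Fin (m j)) (Fin (n j)) ℂ) (Z : Tensor n)
    (hA : ∀ j, PreservesFibers δ A Z j) :
    (1 - δ) ^ d * ‖Z‖ ^ 2 ≤ ‖modewise A Z‖ ^ 2 ∧ ‖modewise A Z‖ ^ 2 ≤ (1 + δ) ^ d * ‖Z‖ ^ 2 := by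
  have hstep : ∀ t, t ≤ d →
      (1 - δ) ^ t * ‖Z‖ ^ 2 ≤ ∑ i, ‖kron (padFirst A t) Z i‖ ^ 2 ∧
      ∑ i, ‖kron (padFirst A t) Z i‖ ^ 2 ≤ (1 + δ) ^ t * ‖Z‖ ^ 2 := by
    intro t
    induction t with
    | zero =>
      intro _
      have : padFirst A 0 = fun _ => 1 := by funext l; simp [padFirst]
      rw [this, kron_one, EuclideanSpace.norm_sq_eq]
      simp
    | succ t ih =>
      intro ht
      obtain ⟨ih1, ih2⟩ := ih (by omega)
      have hup : padFirst A (t + 1) =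
          Function.update (padFirst A t) ⟨t, ht⟩ (padRows (A ⟨t, ht⟩)) := by
        funext l
        by_cases hl : l = ⟨t, ht⟩
        · subst hl; simp [padFirst]
        · have h1 : l.val ≠ t := fun h => hl (Fin.ext h)
          have h2 : l.val < t + 1 ↔ l.val < t := by omega
          rw [Function.update_of_ne hl]
          simp [padFirst, h2]
      have h3 := abs_sum_kron_update_sub_le (padFirst A t) ⟨t, ht⟩ (by simp [padFirst])
        (padRows (A ⟨t, ht⟩)) Z δ (fun q => by
          rw [norm_padRows (h _)]
          exact hA ⟨t, ht⟩ q)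
      rw [← hup, abs_le] at h3
      have hS : 0 ≤ ∑ i, ‖kron (padFirst A t) Z i‖ ^ 2 := by positivity
      have hδ1 : 0 ≤ 1 - δ := by linarith
      constructor
      · calc _ = (1 - δ) * ((1 - δ) ^ t * ‖Z‖ ^ 2) := by ring
          _ ≤ (1 - δ) * ∑ i, ‖kron (padFirst A t) Z i‖ ^ 2 := by gcongr
          _ ≤ _ := by linarith [h3.1]
      · calc _ ≤ (1 + δ) * ∑ i, ‖kron (padFirst A t) Z i‖ ^ 2 := by linarith [h3.2]
          _ ≤ (1 + δ) * ((1 + δ) ^ t * ‖Z‖ ^ 2) := by gcongr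
          _ = _ := by ring
  have hfull : padFirst A d = fun l => padRows (A l) := by funext l; simp [padFirst]
  have := hstep d le_rfl
  rwa [hfull, sum_kron_padRows h A Z] at this


/-! ### Measurability and union bounds -/

/-- With second countability, the product sigma-algebra on tuples of matrices is the Borel one, so
closed conditions on the tuples are measurable. -/
instance instBorelSpaceMatrix (m n : ℕ) : BorelSpace (Matrix (Fin m) (Fin n) ℂ) :=
  inferInstanceAs (BorelSpace (Fin m → Fin n → ℂ))

instance instSecondCountableTopologyMatrix (m n : ℕ) :
    SecondCountableTopology (Matrix (Fin m) (Fin n) ℂ) :=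
  inferInstanceAs (SecondCountableTopology (Fin m → Fin n → ℂ))

theorem continuous_act {X : Type*} [TopologicalSpace X] {m n : ℕ}
    {f : X → Matrix (Fin m) (Fin n) ℂ} {g : X → EuclideanSpace ℂ (Fin n)}
    (hf : Continuous f) (hg : Continuous g) : Continuous fun x => act (f x) (g x) := by
  have : (fun x => act (f x) (g x)) = fun x => WithLp.toLp 2 fun a => ∑ b, f x a b * g x b := by
    funext x
    ext a
    exact act_apply _ _ _
  rw [this]
  refine (PiLp.continuous_toLp 2 _).comp
    (continuous_pi fun a => continuous_finsetSum _ fun b _ => ?_)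
  exact (hf.matrix_elem a b).mul (by fun_prop)

/-- `A` nearly preserves the norms of the elements of `S`. -/
def Preserves {m n : ℕ} (δ : ℝ) (S : Set (EuclideanSpace ℂ (Fin n)))
    (A : Matrix (Fin m) (Fin n) ℂ) : Prop :=
  ∀ x ∈ S, |‖act A x‖ ^ 2 - ‖x‖ ^ 2| ≤ δ * ‖x‖ ^ 2

theorem IsJLEmbedding.preserves {m n : ℕ} {δ : ℝ} {S : Set (EuclideanSpace ℂ (Fin n))}
    {A : Matrix (Fin m) (Fin n) ℂ} (h : IsJLEmbedding δ A S) : Preserves δ S A := by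
  intro x hx
  obtain ⟨e, ⟨he1, he2⟩, h⟩ := h x hx
  rw [h, show (1 + e) * ‖x‖ ^ 2 - ‖x‖ ^ 2 = e * ‖x‖ ^ 2 by ring, abs_mul,
    abs_of_nonneg (sq_nonneg ‖x‖)]
  gcongr
  exact abs_le.mpr ⟨he1.le, he2.le⟩

/-- The non-strict inequality is a closed condition on `A`, so even an uncountable `S` yields a
closed set. -/
theorem measurableSet_preserves {m n : ℕ} (δ : ℝ) (S : Set (EuclideanSpace ℂ (Fin n))) :
    MeasurableSet {A : Matrix (Fin m) (Fin n) ℂ | Preserves δ S A} := by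
  have : {A : Matrix (Fin m) (Fin n) ℂ | Preserves δ S A} =
      ⋂ x ∈ S, {A | |‖act A x‖ ^ 2 - ‖x‖ ^ 2| ≤ δ * ‖x‖ ^ 2} := by
    ext A; simp [Preserves]
  rw [this]
  refine (isClosed_biInter fun x _ => ?_).measurableSet
  have := continuous_act (m := m) continuous_id (continuous_const (y := x))
  simp only [id] at this
  exact isClosed_le (by fun_prop) continuous_const

theorem IsOptimalFamilyWith.le_measure_preserves {η c : ℝ}
    {D : ∀ m n : ℕ, Measure (Matrix (Fin m) (Fin n) ℂ)} (hD : IsOptimalFamilyWith η c D)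
    {δ : ℝ} (hδ : 0 < δ) (hδ1 : δ < 1) {m n : ℕ} (hmn : m < n)
    (S : Finset (EuclideanSpace ℂ (Fin n))) (hS : S.Nonempty)
    (hcard : (S.card : ℝ) ≤ η * Real.exp (δ ^ 2 * m / c)) :
    ENNReal.ofReal (1 - η) ≤ D m n {A | Preserves δ (S : Set _) A} :=
  (hD.2 δ hδ hδ1 m n hmn S hS hcard).trans (measure_mono fun _ h => IsJLEmbedding.preserves h)

theorem IsOptimalFamilyWith.measure_not_preserves_le {η c : ℝ}
    {D : ∀ m n : ℕ, Measure (Matrix (Fin m) (Fin n) ℂ)} (hD : IsOptimalFamilyWith η c D)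
    {δ : ℝ} (hδ : 0 < δ) (hδ1 : δ < 1) {m n : ℕ} (hmn : m < n)
    (S : Finset (EuclideanSpace ℂ (Fin n))) (hS : S.Nonempty)
    (hcard : (S.card : ℝ) ≤ η * Real.exp (δ ^ 2 * m / c)) :
    D m n {A | ¬ Preserves δ (S : Set _) A} ≤ ENNReal.ofReal η := by
  have := hD.1 m n
  have h1 := hD.le_measure_preserves hδ hδ1 hmn S hS hcard
  have h2 := prob_compl_eq_one_sub (μ := D m n) (measurableSet_preserves (m := m) δ (S : Set _))
  rw [Set.compl_ofPred] at h2
  rw [h2]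
  refine (tsub_le_tsub_left h1 1).trans (tsub_le_iff_right.mpr ?_)
  simpa using ENNReal.ofReal_add_le (p := η) (q := 1 - η)

/-- A subset of a product has small measure if all its sections in one coordinate do. -/
theorem pi_le_of_forall_section_le {ι : Type*} [Fintype ι] [DecidableEq ι] {α : ι → Type*}
    [∀ i, MeasurableSpace (α i)] (μ : ∀ i, Measure (α i)) [∀ i, IsProbabilityMeasure (μ i)]
    (j : ι) {B : Set (∀ i, α i)} (hB : MeasurableSet B) (t : ENNReal)
    (h : ∀ x, μ j {a | Function.update x j a ∈ B} ≤ t) : Measure.pi μ B ≤ t := by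
  rw [← lintegral_indicator_one hB]
  have h1 : ∫⁻ x, B.indicator 1 x ∂Measure.pi μ ≤ ∫⁻ _, t ∂Measure.pi μ := by
    refine lintegral_le_of_lmarginal_le {j} (measurable_one.indicator hB) measurable_const ?_
    intro x
    rw [lmarginal_singleton, lmarginal_singleton]
    have h2 : MeasurableSet {a | Function.update x j a ∈ B} := measurable_update x hB
    calc ∫⁻ a, B.indicator 1 (Function.update x j a) ∂μ j
        = ∫⁻ a, {a | Function.update x j a ∈ B}.indicator 1 a ∂μ j := rfl
      _ = μ j {a | Function.update x j a ∈ B} := lintegral_indicator_one h2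
      _ ≤ t := h x
      _ = _ := by simp
  simpa using h1

theorem continuous_kron_padFirst {d : ℕ} {n m : Fin d → ℕ} (t : ℕ) (Z : (∀ l, Fin (n l)) → ℂ)
    (i : ∀ l, Fin (n l)) :
    Continuous fun A : ∀ j, Matrix (Fin (m j)) (Fin (n j)) ℂ => kron (padFirst A t) Z i := by
  unfold kron
  refine continuous_finsetSum _ fun k _ => continuous_const.mul
    (continuous_finsetProd _ fun l _ => ?_)
  by_cases hl : l.val < t
  · by_cases hi : (i l).val < m l
    · simp only [padFirst, hl, if_true, padRows, hi, dite_true]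
      exact (continuous_apply l).matrix_elem _ _
    · simp only [padFirst, hl, if_true, padRows, hi, dite_false]
      exact continuous_const
  · simp only [padFirst, hl, if_false]
    exact continuous_const

theorem measurableSet_preservesFibers {d : ℕ} {n m : Fin d → ℕ} (δ : ℝ) (Z : Tensor n)
    (j : Fin d) :
    MeasurableSet {A : ∀ j, Matrix (Fin (m j)) (Fin (n j)) ℂ | PreservesFibers δ A Z j} := by
  have : {A : ∀ j, Matrix (Fin (m j)) (Fin (n j)) ℂ | PreservesFibers δ A Z j} =
      ⋂ q, {A | |‖act (A j) (fiber j q (kron (padFirst A j) Z))‖ ^ 2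
      - ‖fiber j q (kron (padFirst A j) Z)‖ ^ 2| ≤
        δ * ‖fiber j q (kron (padFirst A j) Z)‖ ^ 2} := by
    ext A; simp [PreservesFibers]
  rw [this]
  refine (isClosed_iInter fun q => ?_).measurableSet
  have h1 : Continuous fun A : ∀ j, Matrix (Fin (m j)) (Fin (n j)) ℂ =>
      fiber j q (kron (padFirst A j) Z) :=
    (PiLp.continuous_toLp 2 _).comp (continuous_pi fun a => continuous_kron_padFirst _ _ _)
  have h2 := continuous_act (continuous_apply j) h1
  exact isClosed_le (by fun_prop) (by fun_prop)

/-- This is where independence enters: the fibers to be preserved by `A j` do not change with `A j`.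
-/
theorem padFirst_update {d : ℕ} {n m : Fin d → ℕ} (A : ∀ j, Matrix (Fin (m j)) (Fin (n j)) ℂ)
    (j : Fin d) (a : Matrix (Fin (m j)) (Fin (n j)) ℂ) :
    padFirst (Function.update A j a) j = padFirst A j := by
  funext l
  by_cases hl : l.val < j.val
  · have : l ≠ j := fun h => by simp [h] at hl
    simp [padFirst, hl, this]
  · simp [padFirst, hl]

theorem card_modes_ne_le {d : ℕ} (n : Fin d → ℕ) {N : ℕ} (hN : 1 ≤ N) (hn : ∀ j, n j ≤ N)
    (j : Fin d) : Fintype.card (∀ l : {l // l ≠ j}, Fin (n l)) ≤ N ^ d := by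
  rw [Fintype.card_pi]
  calc _ ≤ ∏ _l : {l // l ≠ j}, N := Finset.prod_le_prod' fun l _ => by simpa using hn l
    _ = N ^ Fintype.card {l // l ≠ j} := by simp
    _ ≤ N ^ d := Nat.pow_le_pow_right hN (by simp)

/-- With high probability, independent matrices from optimal families nearly preserve all the
fibers met in the successive mode products of finitely many tensors. -/
theorem measure_not_preservesFibers_le {d : ℕ} {n m : Fin d → ℕ} {N : ℕ} (hN : 1 ≤ N)
    (hn : ∀ j, n j ≤ N) (hmn : ∀ j, m j < n j) {η : ℝ} {c : Fin d → ℝ}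
    {D : Fin d → ∀ a b : ℕ, Measure (Matrix (Fin a) (Fin b) ℂ)}
    (hD : ∀ j, IsOptimalFamilyWith η (c j) (D j)) {δ : ℝ} (hδ : 0 < δ) (hδ1 : δ < 1)
    (S : Finset (Tensor n)) (hS : S.Nonempty)
    (hcard : ∀ j, (S.card : ℝ) * N ^ d ≤ η * Real.exp (δ ^ 2 * m j / c j)) (j : Fin d) :
    (Measure.pi fun j => D j (m j) (n j)) {A | ¬ ∀ Z ∈ S, PreservesFibers δ A Z j} ≤
      ENNReal.ofReal η := by
  classical
  have := fun j => (hD j).1 (m j) (n j)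
  have hmeas : MeasurableSet {A : ∀ j, Matrix (Fin (m j)) (Fin (n j)) ℂ |
      ¬ ∀ Z ∈ S, PreservesFibers δ A Z j} := by
    have : {A : ∀ j, Matrix (Fin (m j)) (Fin (n j)) ℂ | ∀ Z ∈ S, PreservesFibers δ A Z j} =
      ⋂ Z ∈ S, {A | PreservesFibers δ A Z j} := by ext A; simp
    refine MeasurableSet.compl (s := {A | ∀ Z ∈ S, PreservesFibers δ A Z j}) ?_
    rw [this]
    exact Finset.measurableSet_biInter _ fun Z _ => measurableSet_preservesFibers δ Z j
  -- All matrices but the `j`-th are frozen. The fibers then form a fixed finite set `F`, to which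
  -- the JL property of `D j` applies.
  refine pi_le_of_forall_section_le _ j hmeas _ fun A => ?_
  let F : Finset (EuclideanSpace ℂ (Fin (n j))) :=
    (S ×ˢ Finset.univ).image fun p => fiber j p.2 (kron (padFirst A j) p.1)
  have hF : F.Nonempty := by
    have : Nonempty (∀ l : {l // l ≠ j}, Fin (n l)) :=
      ⟨fun l => ⟨0, (Nat.zero_le _).trans_lt (hmn l)⟩⟩
    exact (hS.product Finset.univ_nonempty).image _
  have hFc : (F.card : ℝ) ≤ η * Real.exp (δ ^ 2 * m j / c j) := by
    refine le_trans ?_ (hcard j)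
    have h1 : F.card ≤ S.card * N ^ d := by
      refine Finset.card_image_le.trans ?_
      rw [Finset.card_product, Finset.card_univ]
      exact Nat.mul_le_mul_left _ (card_modes_ne_le n hN hn j)
    exact_mod_cast h1
  refine (measure_mono ?_).trans ((hD j).measure_not_preserves_le hδ hδ1 (hmn j) F hF hFc)
  intro a ha hpres
  refine ha fun Z hZ q => ?_
  rw [padFirst_update, Function.update_self]
  exact hpres _ (Finset.mem_coe.mpr (Finset.mem_image.mpr ⟨(Z, q), by simp [hZ], rfl⟩))


/-! ### Nets of subspaces -/

/-- A complex space of dimension at most `k` contains at most `25 ^ (2 * k)` vectors such that a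
linear map which nearly preserves their norms nearly preserves all norms. -/
theorem exists_net_complex (E F : Type*) [NormedAddCommGroup E]
    [InnerProductSpace ℂ E] [FiniteDimensional ℂ E] [NormedAddCommGroup F] [InnerProductSpace ℂ F]
    {k : ℕ} (hk : Module.finrank ℂ E ≤ k) :
    ∃ S : Finset E, S.Nonempty ∧ S.card ≤ 25 ^ (2 * k) ∧
      ∀ (f : E →ₗ[ℂ] F) (δ : ℝ), 0 ≤ δ →
        (∀ y ∈ S, |‖f y‖ ^ 2 - ‖y‖ ^ 2| ≤ δ * ‖y‖ ^ 2) →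
        ∀ x, |‖f x‖ ^ 2 - ‖x‖ ^ 2| ≤ 7 * δ * ‖x‖ ^ 2 := by
  -- The net is taken in the underlying real space, of twice the dimension; hence the exponent `2 *
  -- k`.
  have := FiniteDimensional.complexToReal E
  obtain ⟨s, hne, hcard, hs⟩ := exists_quarter_net E
  refine ⟨s, hne, hcard.trans ?_, fun f δ hδ hf x => ?_⟩
  · rw [finrank_real_of_complex]
    exact Nat.pow_le_pow_right (by norm_num) (by omega)
  · let _ : InnerProductSpace ℝ E := InnerProductSpace.complexToReal
    let _ : InnerProductSpace ℝ F := InnerProductSpace.complexToReal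
    exact abs_norm_sq_sub_le_of_net (f.restrictScalars ℝ) hδ (s : Set E) hs hf x

/-- A `k`-dimensional subspace contains at most `25 ^ (2 * k)` vectors such that a linear map which
nearly preserves their norms nearly preserves all norms in the subspace. -/
theorem exists_net_submodule {E : Type*} (F : Type*) [NormedAddCommGroup E]
    [InnerProductSpace ℂ E] [NormedAddCommGroup F] [InnerProductSpace ℂ F]
    (W : Submodule ℂ E) [FiniteDimensional ℂ W] {k : ℕ} (hk : Module.finrank ℂ W ≤ k) :
    ∃ S : Finset E, S.Nonempty ∧ S.card ≤ 25 ^ (2 * k) ∧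
      ∀ (f : E →ₗ[ℂ] F) (δ : ℝ), 0 ≤ δ →
        (∀ y ∈ S, |‖f y‖ ^ 2 - ‖y‖ ^ 2| ≤ δ * ‖y‖ ^ 2) →
        ∀ x ∈ W, |‖f x‖ ^ 2 - ‖x‖ ^ 2| ≤ 7 * δ * ‖x‖ ^ 2 := by
  classical
  obtain ⟨s, hne, hcard, hs⟩ := exists_net_complex W F hk
  refine ⟨s.image Subtype.val, hne.image _, Finset.card_image_le.trans hcard, ?_⟩
  intro f δ hδ hf x hx
  exact hs (f ∘ₗ W.subtype) δ hδ (fun y hy => hf y (Finset.mem_image_of_mem _ hy)) ⟨x, hx⟩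

/-- A matrix from an optimal family is, with high probability, a subspace embedding. -/
theorem IsOptimalFamilyWith.le_measure_preserves_submodule {η c : ℝ}
    {D : ∀ m n : ℕ, Measure (Matrix (Fin m) (Fin n) ℂ)} (hD : IsOptimalFamilyWith η c D)
    {δ : ℝ} (hδ : 0 < δ) (hδ1 : δ < 1) {m n : ℕ} (hmn : m < n)
    (V : Submodule ℂ (EuclideanSpace ℂ (Fin n))) {k : ℕ} (hk : Module.finrank ℂ V ≤ k)
    (hcard : (25 : ℝ) ^ (2 * k) ≤ η * Real.exp (δ ^ 2 * m / c)) :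
    ENNReal.ofReal (1 - η) ≤ D m n {A | Preserves (7 * δ) (V : Set _) A} := by
  obtain ⟨S, hS, hc, hnet⟩ := exists_net_submodule (EuclideanSpace ℂ (Fin m)) V hk
  refine (hD.le_measure_preserves hδ hδ1 hmn S hS (le_trans ?_ hcard)).trans
    (measure_mono fun A hA => ?_)
  · exact_mod_cast hc
  · exact fun x hx => hnet (Matrix.toEuclideanLin A) δ hδ.le (fun y hy => hA y hy) x hx

/-! ### The modewise map on a subspace -/

/-- The linear map `Z ↦ vect (Z ×₁ A₁ ⋯ ×_d A_d)`. -/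
def vectModewiseLin {d : ℕ} {n m : Fin d → ℕ} (A : ∀ j, Matrix (Fin (m j)) (Fin (n j)) ℂ) :
    Tensor n →ₗ[ℂ] EuclideanSpace ℂ (Fin (∏ j, m j)) where
  toFun Z := vect (modewise A Z)
  map_add' Z Z' := by
    ext q
    simp [vect, modewise_apply, add_mul, Finset.sum_add_distrib]
  map_smul' a Z := by
    ext q
    simp [vect, modewise_apply, Finset.mul_sum, mul_assoc]

theorem norm_vect {d : ℕ} {m : Fin d → ℕ} (Z : Tensor m) : ‖vect Z‖ = ‖Z‖ := by
  rw [EuclideanSpace.norm_eq, EuclideanSpace.norm_eq]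
  congr 1
  exact finPiFinEquiv.symm.sum_comp fun i => ‖Z i‖ ^ 2

theorem one_add_pow_le {d : ℕ} {δ : ℝ} (hδ : 0 ≤ δ) (h : d * δ ≤ 1) :
    (1 + δ) ^ d ≤ 1 + 2 * (d * δ) := by
  have h0 : 0 ≤ d * δ := by positivity
  calc (1 + δ) ^ d ≤ Real.exp δ ^ d := by
        gcongr
        linarith [Real.add_one_le_exp δ]
    _ = Real.exp (d * δ) := (Real.exp_nat_mul _ _).symm
    _ ≤ 1 + 2 * (d * δ) := by
        have := Real.abs_exp_sub_one_le (x := d * δ) (by rwa [abs_of_nonneg h0])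
        rw [abs_of_nonneg h0] at this
        linarith [le_abs_self (Real.exp (d * δ) - 1)]

/-- Bernoulli gives `(1 - δ) ^ d ≥ 1 - d * δ`; above, `(1 + δ) ^ d ≤ exp (d * δ)` costs the factor
2. -/
theorem abs_norm_modewise_sub_le {d : ℕ} {n m : Fin d → ℕ} (h : ∀ j, m j ≤ n j) {δ : ℝ}
    (hδ0 : 0 ≤ δ) (hδ : δ ≤ 1) (hdδ : d * δ ≤ 1) (A : ∀ j, Matrix (Fin (m j)) (Fin (n j)) ℂ)
    (Z : Tensor n) (hA : ∀ j, PreservesFibers δ A Z j) :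
    |‖vectModewiseLin A Z‖ ^ 2 - ‖Z‖ ^ 2| ≤ 2 * (d * δ) * ‖Z‖ ^ 2 := by
  change |‖vect (modewise A Z)‖ ^ 2 - ‖Z‖ ^ 2| ≤ _
  rw [norm_vect]
  obtain ⟨h1, h2⟩ := norm_modewise_bounds h hδ0 hδ A Z hA
  have h3 := mul_le_mul_of_nonneg_right (one_add_pow_le hδ0 hdδ) (sq_nonneg ‖Z‖)
  have h4 := mul_le_mul_of_nonneg_right
    (one_add_mul_le_pow (a := -δ) (by linarith) d) (sq_nonneg ‖Z‖)
  rw [← sub_eq_add_neg 1 δ] at h4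
  have h5 : 0 ≤ d * δ * ‖Z‖ ^ 2 := by positivity
  rw [abs_le]
  constructor <;> nlinarith

/-- Independent matrices from optimal families yield, with high probability, a modewise map that
nearly preserves the norms in a subspace. -/
theorem le_measure_modewise_preserves {d : ℕ} {n m : Fin d → ℕ} {N : ℕ} (hN : 1 ≤ N)
    (hn : ∀ j, n j ≤ N) (hmn : ∀ j, m j < n j) {η : ℝ} (hη : 0 ≤ η) {c : Fin d → ℝ}
    {D : Fin d → ∀ a b : ℕ, Measure (Matrix (Fin a) (Fin b) ℂ)}
    (hD : ∀ j, IsOptimalFamilyWith η (c j) (D j)) {δ : ℝ} (hδ : 0 < δ) (hδ1 : δ < 1)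
    (hdδ : d * δ ≤ 1) (W : Submodule ℂ (Tensor n)) {k : ℕ} (hk : Module.finrank ℂ W ≤ k)
    (hcard : ∀ j, (25 : ℝ) ^ (2 * k) * N ^ d ≤ η * Real.exp (δ ^ 2 * m j / c j)) :
    ENNReal.ofReal (1 - d * η) ≤ (Measure.pi fun j => D j (m j) (n j))
      {A | ∀ Z ∈ W, |‖vectModewiseLin A Z‖ ^ 2 - ‖Z‖ ^ 2| ≤ 7 * (2 * (d * δ)) * ‖Z‖ ^ 2} := by
  have := fun j => (hD j).1 (m j) (n j)
  obtain ⟨S, hS, hc, hnet⟩ := exists_net_submodule (EuclideanSpace ℂ (Fin (∏ j, m j))) W hk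
  have hc' : (S.card : ℝ) ≤ (25 : ℝ) ^ (2 * k) := by exact_mod_cast hc
  set μ := Measure.pi fun j => D j (m j) (n j)
  have hbad : ∀ j, μ {A | ¬ ∀ Z ∈ S, PreservesFibers δ A Z j} ≤ ENNReal.ofReal η :=
    measure_not_preservesFibers_le hN hn hmn hD hδ hδ1 S hS fun j =>
      le_trans (by gcongr) (hcard j)
  set G := {A : ∀ j, Matrix (Fin (m j)) (Fin (n j)) ℂ | ∀ Z ∈ W,
    |‖vectModewiseLin A Z‖ ^ 2 - ‖Z‖ ^ 2| ≤ 7 * (2 * (d * δ)) * ‖Z‖ ^ 2}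
  have hsub : Gᶜ ⊆ ⋃ j, {A | ¬ ∀ Z ∈ S, PreservesFibers δ A Z j} := by
    intro A hA
    by_contra hA'
    simp only [Set.mem_iUnion, Set.mem_ofPred_eq, not_exists, not_not] at hA'
    exact hA fun Z hZ => hnet (vectModewiseLin A) _ (by positivity) (fun y hy =>
      abs_norm_modewise_sub_le (fun j => (hmn j).le) hδ.le hδ1.le hdδ A y fun j => hA' j y hy) Z hZ
  have h1 : μ Gᶜ ≤ ENNReal.ofReal (d * η) := by
    calc μ Gᶜ ≤ ∑ j, μ {A | ¬ ∀ Z ∈ S, PreservesFibers δ A Z j} :=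
          (measure_mono hsub).trans (measure_iUnion_fintype_le _ _)
      _ ≤ ∑ _j : Fin d, ENNReal.ofReal η := Finset.sum_le_sum fun j _ => hbad j
      _ = ENNReal.ofReal (d * η) := by
          rw [Finset.sum_const, Finset.card_univ, Fintype.card_fin, nsmul_eq_mul,
            ENNReal.ofReal_mul (Nat.cast_nonneg d), ENNReal.ofReal_natCast]
  -- Subadditivity alone is used, so `G` need not be shown measurable.
  have h2 : 1 ≤ μ G + μ Gᶜ := by
    rw [← measure_univ (μ := μ), ← Set.union_compl_self G]
    exact measure_union_le _ _
  rw [ENNReal.ofReal_sub _ (by positivity), ENNReal.ofReal_one]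
  exact tsub_le_iff_right.mpr (h2.trans (by gcongr))

/-! ### The cardinality conditions -/

/-- In logarithms, with `a = log N` and `b = -log η`, the claim follows from `4(r+1)a + 2da + b ≤
10r(da + b)`. The summands come from `25 ≤ N ^ 2`, from `N ^ d` and `4 * d ≤ N ^ d`, and from `1 /
η`. -/
theorem card_le_of_mode_dimension {c ε η : ℝ} {d r N : ℕ} {m : ℕ} (hc : 0 < c) (hε : 0 < ε)
    (hη : 0 < η) (hη1 : η < 1) (hd : 1 ≤ d) (hr : 1 ≤ r) (hN : 5 ≤ N)
    (hm : 17640 * c * (r * (d : ℝ) ^ 3 / ε ^ 2 * Real.log (N / η ^ (1 / (d : ℝ)))) ≤ m) :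
    (25 : ℝ) ^ (2 * (r + 1)) * N ^ d ≤
      η / (4 * d) * Real.exp ((ε / (42 * d)) ^ 2 * m / c) := by
  have hd0 : (0 : ℝ) < d := by exact_mod_cast hd
  have hd1 : (1 : ℝ) ≤ d := by exact_mod_cast hd
  have hr1 : (1 : ℝ) ≤ r := by exact_mod_cast hr
  have hN5 : (5 : ℝ) ≤ N := by exact_mod_cast hN
  have hN0 : (0 : ℝ) < N := by linarith
  set a := Real.log N with ha
  set b := -Real.log η with hb
  have ha0 : 0 ≤ a := Real.log_nonneg (by linarith)
  have hb0 : 0 ≤ b := by have := Real.log_neg hη hη1; linarith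
  have hNa : (N : ℝ) = Real.exp a := (Real.exp_log hN0).symm
  have hηb : η = Real.exp (-b) := by rw [hb, neg_neg, Real.exp_log hη]
  have hlog : Real.log (N / η ^ (1 / (d : ℝ))) = a + b / d := by
    rw [Real.log_div hN0.ne' (Real.rpow_pos_of_pos hη _).ne', Real.log_rpow hη]
    rw [hb]; ring
  -- `17640 = 10 * 42 ^ 2`: the square cancels that of `ε / (42 * d)`, and two powers of `d` go with
  -- it.
  have h1 : 10 * r * (d * a + b) ≤ (ε / (42 * d)) ^ 2 * m / c := by
    rw [le_div_iff₀ hc]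
    refine le_trans (le_of_eq ?_) (mul_le_mul_of_nonneg_left hm (sq_nonneg (ε / (42 * d))))
    rw [hlog]
    field_simp
    ring
  have h25 : (25 : ℝ) ^ (2 * (r + 1)) ≤ Real.exp (4 * (r + 1) * a) := by
    calc (25 : ℝ) ^ (2 * (r + 1)) ≤ ((N : ℝ) ^ 2) ^ (2 * (r + 1)) := by gcongr; nlinarith
      _ = Real.exp (4 * (r + 1) * a) := by
          rw [← pow_mul, hNa, ← Real.exp_nat_mul]
          push_cast
          ring_nf
  have h4d : (4 : ℝ) * d ≤ Real.exp (d * a) := by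
    rw [Real.exp_nat_mul, ← hNa]
    have := one_add_mul_le_pow (a := (N : ℝ) - 1) (by linarith) d
    rw [add_sub_cancel] at this
    nlinarith
  have hNd : (N : ℝ) ^ d = Real.exp (d * a) := by rw [Real.exp_nat_mul, ← hNa]
  rw [div_mul_eq_mul_div, le_div_iff₀ (by positivity)]
  calc (25 : ℝ) ^ (2 * (r + 1)) * N ^ d * (4 * d)
      ≤ Real.exp (4 * (r + 1) * a) * Real.exp (d * a) * Real.exp (d * a) := by
        rw [hNd]; gcongr
    _ = Real.exp (4 * (r + 1) * a + d * a + d * a) := by rw [← Real.exp_add, ← Real.exp_add]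
    _ ≤ Real.exp (-b + 10 * r * (d * a + b)) := by
        refine Real.exp_le_exp.mpr ?_
        have e1 : (r : ℝ) * a ≤ r * d * a := by nlinarith [mul_nonneg (by linarith : (0 : ℝ) ≤ r) ha0]
        have e2 : d * a ≤ r * d * a := by nlinarith [mul_nonneg hd0.le ha0]
        have e3 : a ≤ r * a := by nlinarith
        have e4 : b ≤ r * b := by nlinarith
        linarith
    _ = η * Real.exp (10 * r * (d * a + b)) := by rw [Real.exp_add, ← hηb]
    _ ≤ _ := by gcongr

/-- Here `25` and `2` are both at most `47 / ε = exp a`, so `(2r+3)a + b ≤ 5(ra + b)` suffices;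
`2205 = 5 * 21 ^ 2`. -/
theorem card_le_of_final_dimension {c ε η : ℝ} {r : ℕ} {m : ℕ} (hc : 0 < c) (hε : 0 < ε)
    (hε1 : ε < 1) (hη : 0 < η) (hη1 : η < 1) (hr : 1 ≤ r)
    (hm : 2205 * c * (r * (ε ^ 2)⁻¹ * Real.log (47 / (ε * η ^ (1 / (r : ℝ))))) ≤ m) :
    (25 : ℝ) ^ (2 * (r + 1)) ≤ η / 2 * Real.exp ((ε / 21) ^ 2 * m / c) := by
  have hr1 : (1 : ℝ) ≤ r := by exact_mod_cast hr
  have hr0 : (0 : ℝ) < r := by linarith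
  have h47 : 47 ≤ 47 / ε := by rw [le_div_iff₀ hε]; linarith
  set a := Real.log (47 / ε) with ha
  set b := -Real.log η with hb
  have ha0 : 0 ≤ a := Real.log_nonneg (by linarith)
  have hb0 : 0 ≤ b := by have := Real.log_neg hη hη1; linarith
  have hea : Real.exp a = 47 / ε := Real.exp_log (by positivity)
  have hηb : η = Real.exp (-b) := by rw [hb, neg_neg, Real.exp_log hη]
  have hlog : Real.log (47 / (ε * η ^ (1 / (r : ℝ)))) = a + b / r := by
    rw [← div_div, Real.log_div (by positivity) (Real.rpow_pos_of_pos hη _).ne', Real.log_rpow hη]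
    rw [hb]; ring
  have h1 : 5 * (r * a + b) ≤ (ε / 21) ^ 2 * m / c := by
    rw [le_div_iff₀ hc]
    refine le_trans (le_of_eq ?_) (mul_le_mul_of_nonneg_left hm (sq_nonneg (ε / 21)))
    rw [hlog]
    field_simp
    ring
  rw [div_mul_eq_mul_div, le_div_iff₀ two_pos]
  calc (25 : ℝ) ^ (2 * (r + 1)) * 2 ≤ Real.exp a ^ (2 * (r + 1)) * Real.exp a := by
        rw [hea]; gcongr <;> linarith
    _ = Real.exp ((2 * (r + 1) + 1) * a) := by
        rw [← Real.exp_nat_mul, ← Real.exp_add]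
        push_cast
        ring_nf
    _ ≤ Real.exp (-b + 5 * (r * a + b)) := by
        refine Real.exp_le_exp.mpr ?_
        nlinarith
    _ = η * Real.exp (5 * (r * a + b)) := by rw [Real.exp_add, ← hηb]
    _ ≤ _ := by gcongr

/-! ### Two-stage embeddings -/

/-- A subset of a product has large measure if its sections over a large set are large. -/
theorem mul_le_prod_of_section_le {α β : Type*} [MeasurableSpace α] [MeasurableSpace β]
    (μ : Measure α) (ν : Measure β) [SFinite ν] {T : Set (α × β)} (hT : MeasurableSet T)
    {G : Set α} {s t : ENNReal} (hG : s ≤ μ G) (h : ∀ x ∈ G, t ≤ ν (Prod.mk x ⁻¹' T)) :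
    t * s ≤ μ.prod ν T := by
  rw [Measure.prod_apply hT]
  -- Markov's inequality for the measure of the sections. The measurable superlevel set replaces
  -- `G`, which is not assumed measurable.
  calc t * s ≤ t * μ {x | t ≤ ν (Prod.mk x ⁻¹' T)} := by
        gcongr
        exact hG.trans (measure_mono h)
    _ ≤ _ := mul_meas_ge_le_lintegral (measurable_measure_prodMk_left hT) t

theorem continuous_vectModewiseLin {d : ℕ} {n m : Fin d → ℕ} (Z : Tensor n) :
    Continuous fun A : ∀ j, Matrix (Fin (m j)) (Fin (n j)) ℂ => vectModewiseLin A Z := by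
  have : (fun A : ∀ j, Matrix (Fin (m j)) (Fin (n j)) ℂ => vectModewiseLin A Z) =
      fun A => WithLp.toLp 2 fun q => ∑ k : (∀ l, Fin (n l)),
        Z k * ∏ l, A l (finPiFinEquiv.symm q l) (k l) := by
    funext A
    ext q
    exact modewise_apply A Z _
  rw [this]
  refine (PiLp.continuous_toLp 2 _).comp (continuous_pi fun q => continuous_finsetSum _ fun k _ =>
    continuous_const.mul (continuous_finsetProd _ fun l _ => ?_))
  exact (continuous_apply l).matrix_elem _ _

theorem measurableSet_two_stage {d : ℕ} {n m : Fin d → ℕ} {m' : ℕ} (ε : ℝ) (P : Set (Tensor n)) :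
    MeasurableSet {p : (∀ j, Matrix (Fin (m j)) (Fin (n j)) ℂ) ×
      Matrix (Fin m') (Fin (∏ j, m j)) ℂ |
        ∀ Z ∈ P, |‖act p.2 (vectModewiseLin p.1 Z)‖ ^ 2 - ‖Z‖ ^ 2| ≤ ε * ‖Z‖ ^ 2} := by
  have : {p : (∀ j, Matrix (Fin (m j)) (Fin (n j)) ℂ) × Matrix (Fin m') (Fin (∏ j, m j)) ℂ |
        ∀ Z ∈ P, |‖act p.2 (vectModewiseLin p.1 Z)‖ ^ 2 - ‖Z‖ ^ 2| ≤ ε * ‖Z‖ ^ 2} =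
      ⋂ Z ∈ P, {p | |‖act p.2 (vectModewiseLin p.1 Z)‖ ^ 2 - ‖Z‖ ^ 2| ≤ ε * ‖Z‖ ^ 2} := by
    ext p; simp
  rw [this]
  refine (isClosed_biInter fun Z _ => ?_).measurableSet
  have := continuous_act continuous_snd ((continuous_vectModewiseLin (m := m) Z).comp
    (continuous_fst (Y := Matrix (Fin m') (Fin (∏ j, m j)) ℂ)))
  simp only [Function.comp_apply] at this
  exact isClosed_le (by fun_prop) continuous_const

/-- The two relative errors combine to `2ε/3 + ε²/9`, which is at most `ε` for `ε ≤ 1`. -/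
theorem abs_sub_le_of_two_stage {ε a b e : ℝ} (hε : 0 ≤ ε) (hε1 : ε ≤ 1) (he : 0 ≤ e)
    (h1 : |a - b| ≤ ε / 3 * b) (h2 : |e - a| ≤ ε / 3 * a) : |e - b| ≤ ε * b := by
  rw [abs_le] at *
  have hb : 0 ≤ ε * b := by linarith [h1.1, h1.2]
  constructor <;> nlinarith

end ModewiseJL

end

/-! ### The theorem: assembling the two stages -/

theorem mainTheorem4 :
    ∃ K K' : ℝ → ℝ, (∀ c, 0 < c → 0 < K c) ∧ (∀ c, 0 < c → 0 < K' c) ∧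
    ∀ (ε η : ℝ), 0 < ε → ε < 1 / 2 → 0 < η → η < 1 / 2 →
    ∀ (d r : ℕ), 3 ≤ d → 1 ≤ r →
    ∀ (n : Fin d → ℕ) (N : ℕ), N = Finset.univ.sup n → 4 * r + 1 ≤ N →
    -- the tensor `X`, and the subspace `L` with its basis of rank-one tensors
    ∀ (X : ModewiseJL.Tensor n) (L : Submodule ℂ (ModewiseJL.Tensor n))
      (y : ∀ l : Fin d, Fin r → EuclideanSpace ℂ (Fin (n l))),
      (∀ l k, ‖y l k‖ = 1) →
      LinearIndependent ℂ (fun k => ModewiseJL.outer (fun l => y l k)) →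
      L = Submodule.span ℂ (Set.range fun k => ModewiseJL.outer (fun l => y l k)) →
      ModewiseJL.maxCoherence y ^ (d - 1) < 1 / (2 * (r : ℝ)) →
    -- the families of distributions, with their constants
    ∀ (c : Fin d → ℝ) (D : Fin d → ∀ a b : ℕ, MeasureTheory.Measure (Matrix (Fin a) (Fin b) ℂ)),
      (∀ j, 0 < c j) →
      (∀ j, ModewiseJL.IsOptimalFamilyWith (η / (4 * d)) (c j) (D j)) →
    ∀ (c' : ℝ) (D' : ∀ a b : ℕ, MeasureTheory.Measure (Matrix (Fin a) (Fin b) ℂ)),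
      0 < c' → ModewiseJL.IsOptimalFamilyWith (η / 2) c' D' →
    -- the embedding dimensions
    ∀ (m : Fin d → ℕ) (m' : ℕ),
      (∀ j, m j < n j) → m' < ∏ j, m j →
      (∀ j, K (c j) * (r * (d : ℝ) ^ 3 / ε ^ 2 * Real.log (N / η ^ (1 / (d : ℝ)))) ≤ m j) →
      K' c' * (r * (ε ^ 2)⁻¹ * Real.log (47 / (ε * η ^ (1 / (r : ℝ))))) ≤ m' →
    -- all the matrices are drawn independently
    ENNReal.ofReal (1 - η) ≤
      ((MeasureTheory.Measure.pi fun j => D j (m j) (n j)).prod (D' m' (∏ j, m j)))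
        {p : (∀ j, Matrix (Fin (m j)) (Fin (n j)) ℂ) × Matrix (Fin m') (Fin (∏ j, m j)) ℂ |
          ∀ Y ∈ L,
            |‖ModewiseJL.act p.2 (ModewiseJL.vect (ModewiseJL.modewise p.1 (X - Y)))‖ ^ 2
                - ‖X - Y‖ ^ 2| ≤ ε * ‖X - Y‖ ^ 2} := by
  refine ⟨fun c => 17640 * c, fun c => 2205 * c, fun c hc => by positivity,
    fun c hc => by positivity, ?_⟩
  intro ε η hε hε2 hη hη2 d r hd hr n N hN hNr X L y _ _ hL _ c D hc hD c' D' hc' hD' m m' hmn hm'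
    hm hm''
  have := fun j => (hD j).1 (m j) (n j)
  have := hD'.1 m' (∏ j, m j)
  have hd0 : (0 : ℝ) < d := by exact_mod_cast (by omega : 0 < d)
  have hd1 : (1 : ℝ) ≤ d := by exact_mod_cast (by omega : 1 ≤ d)
  have hn : ∀ j, n j ≤ N := fun j => hN ▸ Finset.le_sup (Finset.mem_univ j)
  set W : Submodule ℂ (ModewiseJL.Tensor n) := L ⊔ Submodule.span ℂ {X} with hW
  have hWr : Module.finrank ℂ W ≤ r + 1 := by
    refine (Submodule.finrank_add_le_finrank_add_finrank _ _).trans (Nat.add_le_add ?_ ?_)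
    · rw [hL]
      exact (finrank_range_le_card _).trans (by simp)
    · exact (finrank_span_le_card _).trans (by simp)
  -- With `δ = ε / (42 * d)` the modewise distortion `7 * (2 * (d * δ))` is `ε / 3`; in the second
  -- stage `7 * (ε / 21)` is again `ε / 3`.
  have hdδ : d * (ε / (42 * d)) = ε / 42 := by field_simp
  have hG := ModewiseJL.le_measure_modewise_preserves (by omega) hn hmn (by positivity) hD
    (δ := ε / (42 * d)) (by positivity) (by rw [div_lt_one (by positivity)]; linarith)
    (by rw [hdδ]; linarith) W hWr fun j => ModewiseJL.card_le_of_mode_dimension (hc j) hε hη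
      (by linarith) (by omega) hr (by omega) (hm j)
  rw [hdδ] at hG
  have key := ModewiseJL.mul_le_prod_of_section_le (t := ENNReal.ofReal (1 - η / 2)) _
    (D' m' (∏ j, m j))
    (ModewiseJL.measurableSet_two_stage (m := m) (m' := m') ε {Z | Z ∈ W}) hG fun A hA => by
      refine (hD'.le_measure_preserves_submodule (δ := ε / 21) (by positivity) (by linarith) hm'
        (W.map (ModewiseJL.vectModewiseLin A)) ((Submodule.finrank_map_le _ _).trans hWr)
        (ModewiseJL.card_le_of_final_dimension hc' hε (by linarith) hη (by linarith) hr
          hm'')).trans (measure_mono fun U hU Z hZ => ?_)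
      refine ModewiseJL.abs_sub_le_of_two_stage hε.le (by linarith) (sq_nonneg _)
        ((hA Z hZ).trans (le_of_eq (by ring)))
        ((hU _ (Submodule.mem_map_of_mem hZ)).trans (le_of_eq (by ring)))
  refine le_trans ?_ (key.trans (measure_mono ?_))
  -- The stages fail with probability at most `η / 4` and `η / 2`, and `(1 - η / 2) * (1 - η / 4) ≥
  -- 1 - η`.
  · rw [← ENNReal.ofReal_mul (by linarith)]
    refine ENNReal.ofReal_le_ofReal ?_
    have : d * (η / (4 * d)) = η / 4 := by field_simp
    rw [this]
    nlinarith
  · intro p hp Y hY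
    exact hp (X - Y) (W.sub_mem (Submodule.mem_sup_right (Submodule.mem_span_singleton_self X))
      (Submodule.mem_sup_left hY))
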